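/- Let $n \ge 1$ and let $(\bar g_{ij}(r))_{i,j=2,\dots,n}$ be a symmetric, positive-definite matrix of smooth functions $\bar g_{ij}\colon\mathbb{R}\to\mathbb{R}$. Let $\mathscr{F}_{\bar g}$ denote the set of all (smooth) Riemannian metrics $g_R$ on $\mathbb{R}^{n} = \{(r,x^2,\dots,x^n)\}$ of the form $$g_R = (dr)^2 + \sum_{i,j=2}^n g_{ij}(r,x^2,\dots,x^n)\,dx^i dx^j, \qquad g_{ij}(r,0,\dots,0) = \bar g_{ij}(r) \ \text{ for all } r\in\mathbb{R}.$$ On $\mathbb{R}^{n+1} = \{(r,t,x^2,\dots,x^n)\}$ let $h_{PW}$ be the Lorentzian plane wave metric $$h_{PW} = 2\,dr\,dt + \sum_{i,j=2}^n \bar g_{ij}(r)\,dx^i dx^j.$$ Call a metric Ricci-flat if $\mathrm{Ric}=0$ everywhere, locally symmetric if $\nabla \mathrm{Rm}=0$ everywhere, and say that it has parallel Ricci tensor if $\nabla\mathrm{Ric}=0$ everywhere, where $\nabla$, $\mathrm{Rm}$, $\mathrm{Ric}$ are its Levi-Civita connection, curvature 4-tensor and Ricci tensor. Then: 1. If $h_{PW}$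 is not Ricci-flat, then no $g_R\in\mathscr{F}_{\bar g}$ is Ricci-flat. 2. If $h_{PW}$ is not locally symmetric, then no $g_R\in\mathscr{F}_{\bar g}$ is locally symmetric. 3. If $h_{PW}$ does not have parallel Ricci tensor, then no $g_R\in\mathscr{F}_{\bar g}$ has parallel Ricci tensor. -/

import Mathlib

open scoped ContDiff

/-! Semi-Riemannian geometry of a metric on `ℝ^κ`, in the global coordinates indexed by a finite
type `κ`.  A metric is given by its matrix of components `g x i j = g(∂_i, ∂_j)` at `x`. -/

noncomputable section

namespace CoordMetric

variable {κ : Type} [Fintype κ] [DecidableEq κ]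

/-- The partial derivative `∂_i f` at `x`. -/
def pd (i : κ) (f : (κ → ℝ) → ℝ) (x : κ → ℝ) : ℝ :=
  fderiv ℝ f x (Pi.single i 1)

/-- The Christoffel symbol `Γ^k_{ij}` of the Levi-Civita connection of `g`, that is
`∇_{∂_i} ∂_j = ∑ k, Γ^k_{ij} ∂_k`. -/
def christoffel (g : (κ → ℝ) → Matrix κ κ ℝ) (k i j : κ) (x : κ → ℝ) : ℝ :=
  (1 / 2 : ℝ) * ∑ l, (g x)⁻¹ k l *
    (pd i (fun y => g y j l) x + pd j (fun y => g y i l) x - pd l (fun y => g y i j) x)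

/-- The component `R^l_{ijk}` of the curvature endomorphism,
`R(∂_i, ∂_j) ∂_k = ∇_{∂_i} ∇_{∂_j} ∂_k - ∇_{∂_j} ∇_{∂_i} ∂_k = ∑ l, R^l_{ijk} ∂_l`. -/
def curvature (g : (κ → ℝ) → Matrix κ κ ℝ) (l i j k : κ) (x : κ → ℝ) : ℝ :=
  pd i (christoffel g l j k) x - pd j (christoffel g l i k) x
    + ∑ p, (christoffel g l i p x * christoffel g p j k x
      - christoffel g l j p x * christoffel g p i k x)

/-- The curvature 4-tensor `Rm(∂_i, ∂_j, ∂_k, ∂_l) = g(R(∂_i, ∂_j) ∂_k, ∂_l)`. -/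
def riemann (g : (κ → ℝ) → Matrix κ κ ℝ) (i j k l : κ) (x : κ → ℝ) : ℝ :=
  ∑ p, g x p l * curvature g p i j k x

/-- The Ricci tensor `Ric(∂_j, ∂_k)`, the trace of `X ↦ R(X, ∂_j) ∂_k`. -/
def ricci (g : (κ → ℝ) → Matrix κ κ ℝ) (j k : κ) (x : κ → ℝ) : ℝ :=
  ∑ i, curvature g i i j k x

/-- The covariant derivative `(∇_{∂_a} Rm)(∂_i, ∂_j, ∂_k, ∂_l)`. -/
def covDerivRiemann (g : (κ → ℝ) → Matrix κ κ ℝ) (a i j k l : κ) (x : κ → ℝ) : ℝ :=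
  pd a (riemann g i j k l) x
    - ∑ p, christoffel g p a i x * riemann g p j k l x
    - ∑ p, christoffel g p a j x * riemann g i p k l x
    - ∑ p, christoffel g p a k x * riemann g i j p l x
    - ∑ p, christoffel g p a l x * riemann g i j k p x

/-- The covariant derivative `(∇_{∂_a} Ric)(∂_i, ∂_j)`. -/
def covDerivRicci (g : (κ → ℝ) → Matrix κ κ ℝ) (a i j : κ) (x : κ → ℝ) : ℝ :=
  pd a (ricci g i j) x
    - ∑ p, christoffel g p a i x * ricci g p j x
    - ∑ p, christoffel g p a j x * ricci g i p x

/-- `Ric = 0` everywhere. -/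
def RicciFlat (g : (κ → ℝ) → Matrix κ κ ℝ) : Prop :=
  ∀ x i j, ricci g i j x = 0

/-- `∇ Rm = 0` everywhere. -/
def LocallySymmetric (g : (κ → ℝ) → Matrix κ κ ℝ) : Prop :=
  ∀ x a i j k l, covDerivRiemann g a i j k l x = 0

/-- `∇ Ric = 0` everywhere. -/
def ParallelRicci (g : (κ → ℝ) → Matrix κ κ ℝ) : Prop :=
  ∀ x a i j, covDerivRicci g a i j x = 0

/-- `g` is a smooth Riemannian metric on `ℝ^κ` (symmetry is part of `Matrix.PosDef`). -/
structure IsRiemannian (g : (κ → ℝ) → Matrix κ κ ℝ) : Prop where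
  smooth : ∀ i j, ContDiff ℝ ∞ (fun x => g x i j)
  posDef : ∀ x, (g x).PosDef

end CoordMetric

/-- The set of Riemannian extensions of `gbar`: all Riemannian metrics
`(dr)² + ∑ g_{ij}(r, x) dx^i dx^j` on `ℝ^{1+m}` with `g_{ij}(r, 0) = gbar_{ij}(r)`.
The coordinate `r` has index `Sum.inl 0`, the `m` coordinates `x` have indices `Sum.inr i`. -/
def riemannianExtensions {m : ℕ} (gbar : ℝ → Matrix (Fin m) (Fin m) ℝ) :
    Set ((Fin 1 ⊕ Fin m → ℝ) → Matrix (Fin 1 ⊕ Fin m) (Fin 1 ⊕ Fin m) ℝ) :=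
  {gR | CoordMetric.IsRiemannian gR ∧
    ∃ g : (Fin 1 ⊕ Fin m → ℝ) → Matrix (Fin m) (Fin m) ℝ,
      (∀ x, gR x = Matrix.fromBlocks 1 0 0 (g x)) ∧
      ∀ r : ℝ, g (Sum.elim (fun _ => r) (fun _ => 0)) = gbar r}

/-- The plane wave `2 dr dt + ∑ gbar_{ij}(r) dx^i dx^j` on `ℝ^{2+m}`.  The coordinates `r`, `t`
have indices `Sum.inl 0`, `Sum.inl 1`; the `m` coordinates `x` have indices `Sum.inr i`. -/
def planeWave {m : ℕ} (gbar : ℝ → Matrix (Fin m) (Fin m) ℝ) :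
    (Fin 2 ⊕ Fin m → ℝ) → Matrix (Fin 2 ⊕ Fin m) (Fin 2 ⊕ Fin m) ℝ :=
  fun x => Matrix.fromBlocks !![0, 1; 1, 0] 0 0 (gbar (x (Sum.inl 0)))

end

/-! Both metrics share the same data along an `r`-line. Put `S = ½ gbar⁻¹ gbar'`, `T = -(S' + S²)`,
and let `K` be `T` with an index lowered.

For an extension `gR`, the symbols `Γ^p_{rr}` vanish identically and `Γ^k_{rj} = S` on the line `x =
0`. There `Rm(∂_i, ∂_r, ∂_r, ∂_j) = K_ij` and `Ric(∂_r, ∂_r) = tr T`, and the `∂_r`-derivatives of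
these components involve `gbar` alone (`riemann_inr_inl_inl_inr`, `ricci_inl_inl`,
`covDerivRiemann_inl`, `covDerivRicci_inl`).

For the plane wave these components are the whole curvature: `dr` is parallel, `Rm` is the
Kulkarni-Nomizu type product of `dr²` with `K`, and `Ric = (tr T) dr²` (`riemann_planeWave`,
`ricci_planeWave`). So each condition on `gR`, read off on one line in one direction, forces the
same condition on the plane wave; the theorem is the contrapositive. -/

namespace CoordMetric

open Function

/-! ### Smoothness of the coordinate tensors, and partial derivatives along coordinate lines. -/

section Smoothness

theorem contDiff_det {ι E : Type*} [Fintype ι] [DecidableEq ι] [NormedAddCommGroup E]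
    [NormedSpace ℝ E] {n : WithTop ℕ∞} {M : E → Matrix ι ι ℝ}
    (hM : ∀ i j, ContDiff ℝ n fun x => M x i j) : ContDiff ℝ n fun x => (M x).det := by
  simp only [Matrix.det_apply]
  exact ContDiff.sum fun σ _ => (contDiff_prod fun i _ => hM _ _).const_smul _

theorem contDiff_inv {ι E : Type*} [Fintype ι] [DecidableEq ι] [NormedAddCommGroup E]
    [NormedSpace ℝ E] {n : WithTop ℕ∞} {M : E → Matrix ι ι ℝ}
    (hM : ∀ i j, ContDiff ℝ n fun x => M x i j) (hdet : ∀ x, IsUnit (M x).det) (i j : ι) :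
    ContDiff ℝ n fun x => (M x)⁻¹ i j := by
  simp only [Matrix.inv_def, Matrix.smul_apply, Matrix.adjugate_apply, smul_eq_mul,
    Ring.inverse_eq_inv']
  refine ((contDiff_det hM).inv fun x => (hdet x).ne_zero).mul (contDiff_det fun a b => ?_)
  by_cases h : a = j
  · subst h
    simpa using contDiff_const
  · simpa [Matrix.updateRow_ne h] using hM a b

variable {κ : Type} [Fintype κ] [DecidableEq κ]

theorem contDiff_pd {f : (κ → ℝ) → ℝ} (hf : ContDiff ℝ ∞ f) (i : κ) : ContDiff ℝ ∞ (pd i f) :=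
  (hf.fderiv_right (m := ∞) le_rfl).clm_apply contDiff_const

theorem pd_eq_deriv {f : (κ → ℝ) → ℝ} (hf : ContDiff ℝ ∞ f) (i : κ) (x : κ → ℝ) :
    pd i f x = deriv (fun s => f (update x i s)) (x i) := by
  have h : HasFDerivAt f (fderiv ℝ f x) (update x i (x i)) := by
    rw [update_eq_self]
    exact (hf.differentiable (by simp) x).hasFDerivAt
  exact (h.comp_hasDerivAt (x i) (hasDerivAt_update x i (x i))).deriv.symm

/-- Allows differentiating a function whose values are known only on one coordinate line, which is
all that is known about an extension of `gbar`. -/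
theorem pd_update_eq_deriv {f : (κ → ℝ) → ℝ} (hf : ContDiff ℝ ∞ f) (i : κ) (x : κ → ℝ) (s : ℝ)
    {φ : ℝ → ℝ} (h : ∀ s, f (update x i s) = φ s) : pd i f (update x i s) = deriv φ s := by
  simp [pd_eq_deriv hf, h]

omit [Fintype κ] in
@[simp]
theorem pd_const (i : κ) (a : ℝ) (x : κ → ℝ) : pd i (fun _ => a) x = 0 := by
  simp [pd]

variable {g : (κ → ℝ) → Matrix κ κ ℝ} (hg : ∀ i j, ContDiff ℝ ∞ fun x => g x i j)
  (hdet : ∀ x, IsUnit (g x).det)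
include hg hdet

theorem contDiff_christoffel (k i j : κ) : ContDiff ℝ ∞ (christoffel g k i j) :=
  contDiff_const.mul (ContDiff.sum fun l _ => (contDiff_inv hg hdet k l).mul
    (((contDiff_pd (hg j l) i).add (contDiff_pd (hg i l) j)).sub (contDiff_pd (hg i j) l)))

theorem contDiff_curvature (l i j k : κ) : ContDiff ℝ ∞ (curvature g l i j k) := by
  have hΓ := contDiff_christoffel hg hdet
  exact ((contDiff_pd (hΓ l j k) i).sub (contDiff_pd (hΓ l i k) j)).add
    (ContDiff.sum fun p _ => ((hΓ l i p).mul (hΓ p j k)).sub ((hΓ l j p).mul (hΓ p i k)))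

theorem contDiff_riemann (i j k l : κ) : ContDiff ℝ ∞ (riemann g i j k l) :=
  ContDiff.sum fun p _ => (hg p l).mul (contDiff_curvature hg hdet p i j k)

theorem contDiff_ricci (j k : κ) : ContDiff ℝ ∞ (ricci g j k) :=
  ContDiff.sum fun i _ => contDiff_curvature hg hdet i i j k

end Smoothness

/-! ### One-parameter families of metrics: the endomorphisms `S` and `T`, and the form `K`. -/

section Profile

variable {σ : Type} [Fintype σ] [DecidableEq σ] (gbar : ℝ → Matrix σ σ ℝ)

/-- The endomorphism `½ gbar⁻¹ gbar'` of a one-parameter family of metrics. -/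
noncomputable def shape (k j : σ) (r : ℝ) : ℝ :=
  (1 / 2 : ℝ) * ∑ l, (gbar r)⁻¹ k l * deriv (fun s => gbar s j l) r

/-- The endomorphism `-(S' + S²)`, where `S` is `shape gbar`. -/
noncomputable def tidal (k j : σ) (r : ℝ) : ℝ :=
  -deriv (shape gbar k j) r - ∑ q, shape gbar k q r * shape gbar q j r

/-- The bilinear form obtained from `tidal gbar` by lowering an index. -/
noncomputable def tidalForm (i j : σ) (r : ℝ) : ℝ :=
  ∑ p, gbar r p j * tidal gbar p i r

variable {gbar} (hsmooth : ∀ i j, ContDiff ℝ ∞ fun r => gbar r i j)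
  (hunit : ∀ r, IsUnit (gbar r).det)
include hsmooth hunit

theorem contDiff_shape (k j : σ) : ContDiff ℝ ∞ (shape gbar k j) :=
  contDiff_const.mul (ContDiff.sum fun l _ => (contDiff_inv hsmooth hunit k l).mul
    ((contDiff_infty_iff_deriv.1 (hsmooth j l)).2))

theorem contDiff_tidal (k j : σ) : ContDiff ℝ ∞ (tidal gbar k j) := by
  have h := contDiff_shape hsmooth hunit
  exact (contDiff_infty_iff_deriv.1 (h k j)).2.neg.sub
    (ContDiff.sum fun q _ => (h k q).mul (h q j))

theorem contDiff_tidalForm (i j : σ) : ContDiff ℝ ∞ (tidalForm gbar i j) :=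
  ContDiff.sum fun p _ => (hsmooth p j).mul (contDiff_tidal hsmooth hunit p i)

omit hsmooth in
theorem sum_mul_shape (hsymm : ∀ r, (gbar r).IsSymm) (i j : σ) (r : ℝ) :
    ∑ p, gbar r p j * shape gbar p i r = (1 / 2 : ℝ) * deriv (fun s => gbar s i j) r := by
  have h : ∀ l, ∑ p, gbar r p j * (gbar r)⁻¹ p l = (1 : Matrix σ σ ℝ) j l := fun l => by
    rw [← Matrix.mul_nonsing_inv (gbar r) (hunit r), Matrix.mul_apply]
    exact Finset.sum_congr rfl fun p _ => by rw [(hsymm r).apply]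
  simp only [shape, Finset.mul_sum]
  rw [Finset.sum_comm]
  calc _ = ∑ l, (1 / 2 : ℝ) * deriv (fun s => gbar s i l) r *
          ∑ p, gbar r p j * (gbar r)⁻¹ p l := by
        refine Finset.sum_congr rfl fun l _ => ?_
        rw [Finset.mul_sum]
        exact Finset.sum_congr rfl fun p _ => by ring
    _ = _ := by simp [h, Matrix.one_apply]

/-- Differentiating `gbar S = ½ gbar'` gives `gbar S' = ½ gbar'' - gbar' S`, while `gbar S² = ½
gbar' S`. This form of `K` shows its symmetry and matches what `Γ^t = -½ gbar'` contributes to the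
plane wave curvature. -/
theorem tidalForm_eq (hsymm : ∀ r, (gbar r).IsSymm) (i j : σ) (r : ℝ) :
    tidalForm gbar i j r = -(1 / 2 : ℝ) * deriv (deriv fun s => gbar s i j) r
      + (1 / 2 : ℝ) * ∑ p, deriv (fun s => gbar s p j) r * shape gbar p i r := by
  have hS := contDiff_shape hsmooth hunit
  have hd : ∀ {f : ℝ → ℝ}, ContDiff ℝ ∞ f → DifferentiableAt ℝ f r :=
    fun hf => hf.differentiable (by simp) r
  have h1 : ∑ p, (deriv (fun s => gbar s p j) r * shape gbar p i r
      + gbar r p j * deriv (shape gbar p i) r)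
      = (1 / 2 : ℝ) * deriv (deriv fun s => gbar s i j) r := by
    rw [← deriv_const_mul _ (hd (contDiff_infty_iff_deriv.1 (hsmooth i j)).2)]
    have : (fun s => (1 / 2 : ℝ) * deriv (fun s => gbar s i j) s)
        = fun s => ∑ p, gbar s p j * shape gbar p i s :=
      funext fun s => (sum_mul_shape hunit hsymm i j s).symm
    rw [this]
    exact (HasDerivAt.fun_sum fun p _ =>
      (hd (hsmooth p j)).hasDerivAt.mul (hd (hS p i)).hasDerivAt).deriv.symm
  have h2 : ∑ p, gbar r p j * ∑ q, shape gbar p q r * shape gbar q i r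
      = (1 / 2 : ℝ) * ∑ q, deriv (fun s => gbar s q j) r * shape gbar q i r := by
    simp only [Finset.mul_sum]
    rw [Finset.sum_comm]
    refine Finset.sum_congr rfl fun q _ => ?_
    rw [← mul_assoc, ← sum_mul_shape hunit hsymm q j r, Finset.sum_mul]
    exact Finset.sum_congr rfl fun p _ => by ring
  simp only [tidalForm, tidal, mul_sub, mul_neg, Finset.sum_sub_distrib, Finset.sum_neg_distrib,
    h2]
  rw [Finset.sum_add_distrib] at h1
  linarith

omit hsmooth hunit in
-- Up to the factor `½`, both sides are entries of `gbar' gbar⁻¹ gbar'`, a symmetric matrix.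
theorem sum_deriv_mul_shape_comm (hsymm : ∀ r, (gbar r).IsSymm) (i j : σ) (r : ℝ) :
    ∑ p, deriv (fun s => gbar s p j) r * shape gbar p i r
      = ∑ p, deriv (fun s => gbar s p i) r * shape gbar p j r := by
  have hs : ∀ i j, (fun s => gbar s i j) = fun s => gbar s j i :=
    fun i j => funext fun s => (hsymm s).apply _ _
  have hi : ∀ i j, (gbar r)⁻¹ i j = (gbar r)⁻¹ j i := fun i j => by
    conv_lhs => rw [← (hsymm r).eq, ← Matrix.transpose_nonsing_inv]
    rfl
  simp only [shape, Finset.mul_sum]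
  rw [Finset.sum_comm]
  refine Finset.sum_congr rfl fun p _ => Finset.sum_congr rfl fun q _ => ?_
  rw [hi q p, hs q j, hs p i]
  ring

theorem tidalForm_comm (hsymm : ∀ r, (gbar r).IsSymm) (i j : σ) (r : ℝ) :
    tidalForm gbar i j r = tidalForm gbar j i r := by
  rw [tidalForm_eq hsmooth hunit hsymm, tidalForm_eq hsmooth hunit hsymm,
    sum_deriv_mul_shape_comm hsymm, show (fun s => gbar s i j) = fun s => gbar s j i from
      funext fun s => (hsymm s).apply _ _]

end Profile

/-! ### Block metrics with a constant first block, computed along one coordinate line. -/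

section Block

variable {τ σ : Type} [Fintype τ] [DecidableEq τ] [Fintype σ] [DecidableEq σ]
  {g : (τ ⊕ σ → ℝ) → Matrix (τ ⊕ σ) (τ ⊕ σ) ℝ} {c : Matrix τ τ ℝ}
  {G : (τ ⊕ σ → ℝ) → Matrix σ σ ℝ}

theorem inv_fromBlocks_diagonal {c : Matrix τ τ ℝ} {M : Matrix σ σ ℝ} (hc : IsUnit c.det)
    (hM : IsUnit M.det) : (Matrix.fromBlocks c 0 0 M)⁻¹ = Matrix.fromBlocks c⁻¹ 0 0 M⁻¹ := by
  refine Matrix.inv_eq_right_inv ?_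
  simp [Matrix.fromBlocks_multiply, Matrix.mul_nonsing_inv _ hc, Matrix.mul_nonsing_inv _ hM]

variable (hgG : ∀ x, g x = Matrix.fromBlocks c 0 0 (G x))
include hgG

theorem christoffel_inl_inl (p : τ ⊕ σ) (a b : τ) : christoffel g p (.inl a) (.inl b) = 0 := by
  funext x
  simp [christoffel, hgG]

theorem isUnit_det_block (hc : IsUnit c.det) (hG : ∀ x, IsUnit (G x).det) (x : τ ⊕ σ → ℝ) :
    IsUnit (g x).det := by
  rw [hgG, Matrix.det_fromBlocks_zero₂₁]
  exact hc.mul (hG x)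

variable (hc : IsUnit c.det) (hG : ∀ x, IsUnit (G x).det)
include hc hG

theorem christoffel_inl_inl_inr (a b : τ) (j : σ) :
    christoffel g (.inl a) (.inl b) (.inr j) = 0 := by
  funext x
  simp [christoffel, hgG, inv_fromBlocks_diagonal hc (hG x)]

variable (hg : ∀ i j, ContDiff ℝ ∞ fun x => g x i j) {z : τ} {x : τ ⊕ σ → ℝ}
  {gbar : ℝ → Matrix σ σ ℝ} (hline : ∀ s, G (update x (.inl z) s) = gbar s)
include hg hline

theorem christoffel_inr_inl_inr (k j : σ) (s : ℝ) :
    christoffel g (.inr k) (.inl z) (.inr j) (update x (.inl z) s) = shape gbar k j s := by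
  have h : ∀ l, pd (.inl z) (fun y => G y j l) (update x (.inl z) s)
      = deriv (fun s => gbar s j l) s := fun l =>
    pd_update_eq_deriv (by simpa [hgG] using hg (.inr j) (.inr l)) _ _ _ fun s => by rw [hline]
  have hi := inv_fromBlocks_diagonal hc (hG (update x (.inl z) s))
  rw [hline] at hi
  simp [christoffel, shape, hgG, hi, h, hline]

theorem christoffel_inr_inr_inl (k j : σ) (s : ℝ) :
    christoffel g (.inr k) (.inr j) (.inl z) (update x (.inl z) s) = shape gbar k j s := by
  have h : ∀ l, pd (.inl z) (fun y => G y j l) (update x (.inl z) s)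
      = deriv (fun s => gbar s j l) s := fun l =>
    pd_update_eq_deriv (by simpa [hgG] using hg (.inr j) (.inr l)) _ _ _ fun s => by rw [hline]
  have hi := inv_fromBlocks_diagonal hc (hG (update x (.inl z) s))
  rw [hline] at hi
  simp [christoffel, shape, hgG, hi, h, hline]

/-- Since `Γ^p_{zz}` vanishes everywhere, not just on the line, the only transverse derivative in
the formula drops out; what remains is determined by values on the line. -/
theorem curvature_inr_inr_inl_inl (k j : σ) (s : ℝ) :
    curvature g (.inr k) (.inr j) (.inl z) (.inl z) (update x (.inl z) s) = tidal gbar k j s := by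
  have hdet := isUnit_det_block hgG hc hG
  have h : pd (.inl z) (christoffel g (.inr k) (.inr j) (.inl z)) (update x (.inl z) s)
      = deriv (shape gbar k j) s :=
    pd_update_eq_deriv (contDiff_christoffel hg hdet _ _ _) _ _ _
      (christoffel_inr_inr_inl hgG hc hG hg hline k j)
  -- `christoffel_inl_inl` rewrites to the zero function `0`, which does not match the lambda in
  -- `pd_const` syntactically.
  have h0 : ∀ i : τ ⊕ σ, ∀ y, pd i (0 : (τ ⊕ σ → ℝ) → ℝ) y = 0 := fun i y => pd_const i 0 y
  simp [curvature, tidal, h, h0, christoffel_inl_inl hgG, christoffel_inr_inl_inr hgG hc hG hg hline,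
    christoffel_inr_inr_inl hgG hc hG hg hline, sub_eq_add_neg]

theorem riemann_inr_inl_inl_inr (i j : σ) (s : ℝ) :
    riemann g (.inr i) (.inl z) (.inl z) (.inr j) (update x (.inl z) s)
      = tidalForm gbar i j s := by
  simp [riemann, tidalForm, curvature_inr_inr_inl_inl hgG hc hG hg hline, hgG, hline]

theorem ricci_inl_inl (s : ℝ) :
    ricci g (.inl z) (.inl z) (update x (.inl z) s) = ∑ i, tidal gbar i i s := by
  have h0 : ∀ i : τ ⊕ σ, ∀ y, pd i (0 : (τ ⊕ σ → ℝ) → ℝ) y = 0 := fun i y => pd_const i 0 y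
  have h : ∀ a : τ, curvature g (.inl a) (.inl a) (.inl z) (.inl z) (update x (.inl z) s) = 0 := by
    intro a
    simp [curvature, christoffel_inl_inl hgG, h0]
  simp [ricci, h, curvature_inr_inr_inl_inl hgG hc hG hg hline]

/-- The two middle slots give no correction because `Γ^p_{zz} = 0`; the outer slots are corrected by
`S` only, because `Γ^a_{zj} = 0` for `a` in the constant block. -/
theorem covDerivRiemann_inl (i j : σ) (s : ℝ) :
    covDerivRiemann g (.inl z) (.inr i) (.inl z) (.inl z) (.inr j) (update x (.inl z) s)
      = deriv (tidalForm gbar i j) s - ∑ p, shape gbar p i s * tidalForm gbar p j s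
        - ∑ p, shape gbar p j s * tidalForm gbar i p s := by
  have hdet := isUnit_det_block hgG hc hG
  have hR := riemann_inr_inl_inl_inr hgG hc hG hg hline
  have h : pd (.inl z) (riemann g (.inr i) (.inl z) (.inl z) (.inr j)) (update x (.inl z) s)
      = deriv (tidalForm gbar i j) s :=
    pd_update_eq_deriv (contDiff_riemann hg hdet _ _ _ _) _ _ _ (hR i j)
  simp [covDerivRiemann, h, hR, christoffel_inl_inl hgG, christoffel_inl_inl_inr hgG hc hG,
    christoffel_inr_inl_inr hgG hc hG hg hline]

theorem covDerivRicci_inl (s : ℝ) :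
    covDerivRicci g (.inl z) (.inl z) (.inl z) (update x (.inl z) s)
      = deriv (fun s => ∑ i, tidal gbar i i s) s := by
  have hdet := isUnit_det_block hgG hc hG
  have h := pd_update_eq_deriv (contDiff_ricci hg hdet _ _) _ x s
    (ricci_inl_inl hgG hc hG hg hline)
  simp [covDerivRicci, h, christoffel_inl_inl hgG]

end Block

/-! ### Curvature of the plane wave and its covariant derivative. -/

section PlaneWave

variable {m : ℕ} {gbar : ℝ → Matrix (Fin m) (Fin m) ℝ}

/-- The components of the covector `dr` on `ℝ^{2+m}`. -/
def drComponent : Fin 2 ⊕ Fin m → ℝ := Sum.elim ![1, 0] 0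

/-- Extension by zero of a covector on `ℝ^m` to `ℝ^{2+m}`. -/
def transverse (v : Fin m → ℝ) : Fin 2 ⊕ Fin m → ℝ := Sum.elim 0 v

/-- Extension by zero of a bilinear form on `ℝ^m` to `ℝ^{2+m}`. -/
def transverseForm (M : Fin m → Fin m → ℝ) (i j : Fin 2 ⊕ Fin m) : ℝ :=
  transverse (fun i => transverse (M i) j) i

theorem pd_comp_coord {φ : ℝ → ℝ} (hφ : ContDiff ℝ ∞ φ) (i : Fin 2 ⊕ Fin m)
    (x : Fin 2 ⊕ Fin m → ℝ) :
    pd i (fun y => φ (y (.inl 0))) x = drComponent i * deriv φ (x (.inl 0)) := by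
  have hf : ContDiff ℝ ∞ fun y : Fin 2 ⊕ Fin m → ℝ => φ (y (.inl 0)) :=
    hφ.comp (contDiff_apply ℝ ℝ _)
  rw [pd_eq_deriv hf]
  rcases i with i | i
  · fin_cases i <;> simp [drComponent]
  · simp [drComponent]

variable (hsmooth : ∀ i j, ContDiff ℝ ∞ fun r => gbar r i j)
  (hunit : ∀ r, IsUnit (gbar r).det)

theorem isUnit_det_null : IsUnit (!![0, 1; 1, 0] : Matrix (Fin 2) (Fin 2) ℝ).det := by
  simp [Matrix.det_fin_two]

theorem inv_null : (!![0, 1; 1, 0] : Matrix (Fin 2) (Fin 2) ℝ)⁻¹ = !![0, 1; 1, 0] := by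
  refine Matrix.inv_eq_right_inv ?_
  ext i j
  fin_cases i <;> fin_cases j <;> simp [Matrix.mul_apply]

include hsmooth in
theorem pd_planeWave (a i j : Fin 2 ⊕ Fin m) (x : Fin 2 ⊕ Fin m → ℝ) :
    pd a (fun y => planeWave gbar y i j) x = drComponent a *
      transverseForm (fun i j => deriv (fun s => gbar s i j) (x (.inl 0))) i j := by
  rcases i with i | i <;> rcases j with j | j <;>
    simp [planeWave, pd_comp_coord (hsmooth _ _), transverseForm, transverse, pd_const]

include hunit in
theorem inv_planeWave (x : Fin 2 ⊕ Fin m → ℝ) :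
    (planeWave gbar x)⁻¹ = Matrix.fromBlocks !![0, 1; 1, 0] 0 0 (gbar (x (.inl 0)))⁻¹ := by
  rw [planeWave, inv_fromBlocks_diagonal isUnit_det_null (hunit _), inv_null]

include hsmooth hunit

/-- The inverse metric pairs `r` with `t`, and nothing depends on `t` or has a nonconstant
`t`-component. Equivalently, `dr` is parallel. -/
theorem christoffel_planeWave_r (i j : Fin 2 ⊕ Fin m) :
    christoffel (planeWave gbar) (.inl 0) i j = 0 := by
  funext x
  simp only [christoffel, inv_planeWave hunit, pd_planeWave hsmooth]
  rcases i with i | i <;> rcases j with j | j <;> simp [drComponent, transverseForm, transverse]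

theorem christoffel_planeWave_t (i j : Fin 2 ⊕ Fin m) :
    christoffel (planeWave gbar) (.inl 1) i j = fun x =>
      transverseForm (fun i j => -(1 / 2 : ℝ) * deriv (fun s => gbar s i j) (x (.inl 0))) i j := by
  funext x
  simp only [christoffel, inv_planeWave hunit, pd_planeWave hsmooth]
  rcases i with i | i <;> rcases j with j | j <;> simp [drComponent, transverseForm, transverse]

theorem christoffel_planeWave_inr (k : Fin m) (i j : Fin 2 ⊕ Fin m) :
    christoffel (planeWave gbar) (.inr k) i j = fun x =>
      drComponent i * transverse (fun j => shape gbar k j (x (.inl 0))) j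
      + drComponent j * transverse (fun i => shape gbar k i (x (.inl 0))) i := by
  funext x
  simp only [christoffel, inv_planeWave hunit, pd_planeWave hsmooth, shape]
  rcases i with i | i <;> rcases j with j | j <;>
    simp [drComponent, transverseForm, transverse, Finset.mul_sum, mul_left_comm]

theorem pd_christoffel_planeWave_r (i j k : Fin 2 ⊕ Fin m) (x : Fin 2 ⊕ Fin m → ℝ) :
    pd i (christoffel (planeWave gbar) (.inl 0) j k) x = 0 := by
  rw [christoffel_planeWave_r hsmooth hunit]
  exact pd_const i 0 x

theorem pd_christoffel_planeWave_t (i j k : Fin 2 ⊕ Fin m) (x : Fin 2 ⊕ Fin m → ℝ) :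
    pd i (christoffel (planeWave gbar) (.inl 1) j k) x = drComponent i * transverseForm
      (fun i j => -(1 / 2 : ℝ) * deriv (deriv fun s => gbar s i j) (x (.inl 0))) j k := by
  have h := fun i j => (contDiff_infty_iff_deriv.1 (hsmooth i j)).2
  rw [christoffel_planeWave_t hsmooth hunit]
  rcases j with j | j <;> rcases k with k | k <;>
    simp only [transverseForm, transverse, Sum.elim_inl, Sum.elim_inr, Pi.zero_apply, pd_const,
      mul_zero]
  rw [pd_comp_coord (φ := fun r => -(1 / 2 : ℝ) * deriv (fun s => gbar s j k) r)
    (contDiff_const.mul (h j k)), deriv_const_mul_field]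

theorem pd_christoffel_planeWave_inr (l : Fin m) (i j k : Fin 2 ⊕ Fin m)
    (x : Fin 2 ⊕ Fin m → ℝ) :
    pd i (christoffel (planeWave gbar) (.inr l) j k) x = drComponent i *
      (drComponent j * transverse (fun k => deriv (shape gbar l k) (x (.inl 0))) k
      + drComponent k * transverse (fun j => deriv (shape gbar l j) (x (.inl 0))) j) := by
  have h := contDiff_shape hsmooth hunit
  rw [christoffel_planeWave_inr hsmooth hunit]
  rcases j with j | j <;> rcases k with k | k <;>
    simp only [drComponent, transverse, Sum.elim_inl, Sum.elim_inr, Pi.zero_apply, pd_const,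
      mul_zero, zero_mul, add_zero, zero_add]
  · rw [pd_comp_coord (φ := fun r => ![1, 0] j * shape gbar l k r) (contDiff_const.mul (h l k)),
      deriv_const_mul_field]
    rfl
  · rw [pd_comp_coord (φ := fun r => ![1, 0] k * shape gbar l j r) (contDiff_const.mul (h l j)),
      deriv_const_mul_field]
    rfl

theorem curvature_planeWave_r (i j k : Fin 2 ⊕ Fin m) (x : Fin 2 ⊕ Fin m → ℝ) :
    curvature (planeWave gbar) (.inl 0) i j k x = 0 := by
  simp only [curvature, pd_christoffel_planeWave_r hsmooth hunit]
  simp [christoffel_planeWave_r hsmooth hunit]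

theorem curvature_planeWave_inr (l : Fin m) (i j k : Fin 2 ⊕ Fin m) (x : Fin 2 ⊕ Fin m → ℝ) :
    curvature (planeWave gbar) (.inr l) i j k x = drComponent k *
      (drComponent j * transverse (fun i => tidal gbar l i (x (.inl 0))) i
        - drComponent i * transverse (fun j => tidal gbar l j (x (.inl 0))) j) := by
  simp only [curvature, pd_christoffel_planeWave_inr hsmooth hunit]
  simp only [Fintype.sum_sum_type, Fin.sum_univ_two, christoffel_planeWave_r hsmooth hunit,
    christoffel_planeWave_t hsmooth hunit, christoffel_planeWave_inr hsmooth hunit]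
  rcases i with i | i <;> rcases j with j | j <;> rcases k with k | k <;>
    simp [drComponent, transverse, tidal, Finset.mul_sum, mul_sub]
  · fin_cases i <;> fin_cases j <;> simp
  · fin_cases i <;> fin_cases k <;> simp [add_comm]
  · fin_cases j <;> fin_cases k <;> simp [sub_eq_add_neg]

theorem curvature_planeWave_t (hsymm : ∀ r, (gbar r).IsSymm) (i j k : Fin 2 ⊕ Fin m)
    (x : Fin 2 ⊕ Fin m → ℝ) :
    curvature (planeWave gbar) (.inl 1) i j k x =
      drComponent i * transverseForm (fun j k => tidalForm gbar j k (x (.inl 0))) j k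
        - drComponent j * transverseForm (fun i k => tidalForm gbar i k (x (.inl 0))) i k := by
  simp only [curvature, pd_christoffel_planeWave_t hsmooth hunit]
  simp only [Fintype.sum_sum_type, Fin.sum_univ_two, christoffel_planeWave_r hsmooth hunit,
    christoffel_planeWave_t hsmooth hunit, christoffel_planeWave_inr hsmooth hunit]
  have hC : ∀ i k r, ∑ p, deriv (fun s => gbar s p k) r * shape gbar p i r
      = ∑ p, deriv (fun s => gbar s i p) r * shape gbar p k r := fun i k r => by
    rw [sum_deriv_mul_shape_comm hsymm]
    exact Finset.sum_congr rfl fun p _ => by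
      rw [show (fun s => gbar s i p) = fun s => gbar s p i from
        funext fun s => (hsymm s).apply _ _]
  rcases i with i | i <;> rcases j with j | j <;> rcases k with k | k <;>
    simp [drComponent, transverse, transverseForm, tidalForm_eq hsmooth hunit hsymm]
  · fin_cases i <;> simp [hC, Finset.mul_sum, mul_assoc]
  · fin_cases j <;> simp [hC, Finset.mul_sum, mul_assoc, add_comm]
  -- Here the terms carrying `dr_k` must cancel; they do because `gbar' S` is symmetric.
  · fin_cases k
    · have h := sum_deriv_mul_shape_comm hsymm i j (x (.inl 0))
      rw [hC] at h
      rw [Finset.sum_add_distrib, Finset.sum_neg_distrib]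
      simp [mul_assoc, ← Finset.mul_sum, h, hC j i]
    · simp

theorem riemann_planeWave (hsymm : ∀ r, (gbar r).IsSymm) (i j k l : Fin 2 ⊕ Fin m)
    (x : Fin 2 ⊕ Fin m → ℝ) :
    riemann (planeWave gbar) i j k l x =
      let K := transverseForm fun i j => tidalForm gbar i j (x (.inl 0))
      drComponent j * drComponent k * K i l - drComponent i * drComponent k * K j l
        - drComponent j * drComponent l * K i k + drComponent i * drComponent l * K j k := by
  rcases l with l | l
  · fin_cases l
    · simp [riemann, planeWave, curvature_planeWave_t hsmooth hunit hsymm]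
      rcases i with i | i <;> rcases j with j | j <;> rcases k with k | k <;>
        simp [drComponent, transverse, transverseForm]
    · simp [riemann, planeWave, curvature_planeWave_r hsmooth hunit]
      rcases i with i | i <;> rcases j with j | j <;> rcases k with k | k <;>
        simp [drComponent, transverse, transverseForm]
  · simp [riemann, planeWave, curvature_planeWave_inr hsmooth hunit]
    rcases i with i | i <;> rcases j with j | j <;> rcases k with k | k <;>
      simp [drComponent, transverse, transverseForm, tidalForm]
    · fin_cases i <;> fin_cases k <;> simp
    · fin_cases j <;> fin_cases k <;> simp

theorem ricci_planeWave (hsymm : ∀ r, (gbar r).IsSymm) (j k : Fin 2 ⊕ Fin m)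
    (x : Fin 2 ⊕ Fin m → ℝ) :
    ricci (planeWave gbar) j k x =
      drComponent j * drComponent k * ∑ i, tidal gbar i i (x (.inl 0)) := by
  simp [ricci, curvature_planeWave_r hsmooth hunit, curvature_planeWave_t hsmooth hunit hsymm,
    curvature_planeWave_inr hsmooth hunit, drComponent, transverse, transverseForm, Finset.mul_sum,
    mul_left_comm, mul_assoc]

/-- Parallelism of `dr` in the form that removes every Christoffel correction falling on a factor
`dr`. -/
theorem christoffel_mul_drComponent (a i : Fin 2 ⊕ Fin m) (x : Fin 2 ⊕ Fin m → ℝ)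
    (p : Fin 2 ⊕ Fin m) : christoffel (planeWave gbar) p a i x * drComponent p = 0 := by
  rcases p with p | p
  · fin_cases p
    · simp [christoffel_planeWave_r hsmooth hunit]
    · simp [drComponent]
  · simp [drComponent]

/-- The covariant derivative of the symmetric form `tidalForm gbar`, extended by zero to
`ℝ^{2+m}`, is a symmetric product of `dr` with a covector once its `∂_r`-part vanishes. -/
theorem exists_covDeriv_tidalForm (hsymm : ∀ r, (gbar r).IsSymm)
    (hpar : ∀ i j s, deriv (tidalForm gbar i j) s - ∑ p, shape gbar p i s * tidalForm gbar p j s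
        - ∑ p, shape gbar p j s * tidalForm gbar i p s = 0)
    (a : Fin 2 ⊕ Fin m) (x : Fin 2 ⊕ Fin m → ℝ) :
    let K := transverseForm fun i j => tidalForm gbar i j (x (.inl 0))
    ∃ V : Fin 2 ⊕ Fin m → ℝ, ∀ i l,
      drComponent a * transverseForm (fun i j => deriv (tidalForm gbar i j) (x (.inl 0))) i l
        - ∑ p, christoffel (planeWave gbar) p a i x * K p l
        - ∑ p, christoffel (planeWave gbar) p a l x * K i p
      = drComponent i * V l + drComponent l * V i := by
  intro K
  simp only [Fintype.sum_sum_type, Fin.sum_univ_two, christoffel_planeWave_inr hsmooth hunit]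
  rcases a with a | c
  · refine ⟨0, fun i l => ?_⟩
    fin_cases a
    · rcases i with i | i <;> rcases l with l | l <;>
        simp [K, drComponent, transverse, transverseForm, hpar]
    · rcases i with i | i <;> rcases l with l | l <;>
        simp [K, drComponent, transverse, transverseForm]
  -- For transverse directions, `Γ^q_{ci} = dr_i S^q_c`, so each correction already carries a factor
  -- `dr`; `V` is its cofactor.
  · refine ⟨transverse fun l =>
      -∑ q, shape gbar q c (x (.inl 0)) * tidalForm gbar q l (x (.inl 0)), fun i l => ?_⟩
    rcases i with i | i <;> rcases l with l | l <;>
      simp [K, drComponent, transverse, transverseForm, Finset.mul_sum, mul_assoc,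
        tidalForm_comm hsmooth hunit hsymm]

theorem pd_riemann_planeWave (hsymm : ∀ r, (gbar r).IsSymm) (a i j k l : Fin 2 ⊕ Fin m)
    (x : Fin 2 ⊕ Fin m → ℝ) :
    pd a (riemann (planeWave gbar) i j k l) x =
      let K := transverseForm fun i j => deriv (tidalForm gbar i j) (x (.inl 0))
      drComponent a * (drComponent j * drComponent k * K i l - drComponent i * drComponent k * K j l
        - drComponent j * drComponent l * K i k + drComponent i * drComponent l * K j k) := by
  have hK : ∀ i j, ContDiff ℝ ∞ fun r => transverseForm (fun i j => tidalForm gbar i j r) i j := by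
    intro i j
    rcases i with i | i <;> rcases j with j | j <;> try exact contDiff_const
    exact contDiff_tidalForm hsmooth hunit i j
  have hd : ∀ i j r, HasDerivAt (fun r => transverseForm (fun i j => tidalForm gbar i j r) i j)
      (transverseForm (fun i j => deriv (tidalForm gbar i j) r) i j) r := by
    intro i j r
    rcases i with i | i <;> rcases j with j | j <;> try exact hasDerivAt_const r 0
    exact ((contDiff_tidalForm hsmooth hunit i j).differentiable (by simp) r).hasDerivAt
  have e : riemann (planeWave gbar) i j k l = _ :=
    funext fun x => riemann_planeWave hsmooth hunit hsymm i j k l x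
  rw [e, pd_comp_coord (φ := fun r =>
    let K := transverseForm fun i j => tidalForm gbar i j r
    drComponent j * drComponent k * K i l - drComponent i * drComponent k * K j l
      - drComponent j * drComponent l * K i k + drComponent i * drComponent l * K j k)]
  · congr 1
    exact (((((hd i l _).const_mul _).sub ((hd j l _).const_mul _)).sub
      ((hd i k _).const_mul _)).add ((hd j k _).const_mul _)).deriv
  · exact (((contDiff_const.mul (hK i l)).sub (contDiff_const.mul (hK j l))).sub
      (contDiff_const.mul (hK i k))).add (contDiff_const.mul (hK j k))

theorem locallySymmetric_planeWave (hsymm : ∀ r, (gbar r).IsSymm)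
    (hpar : ∀ i j s, deriv (tidalForm gbar i j) s - ∑ p, shape gbar p i s * tidalForm gbar p j s
        - ∑ p, shape gbar p j s * tidalForm gbar i p s = 0) :
    LocallySymmetric (planeWave gbar) := by
  intro x a i j k l
  obtain ⟨V, hV⟩ := exists_covDeriv_tidalForm hsmooth hunit hsymm hpar a x
  have hdr := christoffel_mul_drComponent hsmooth hunit a
  rw [covDerivRiemann, pd_riemann_planeWave hsmooth hunit hsymm]
  simp only [riemann_planeWave hsmooth hunit hsymm]
  set K := transverseForm fun i j => tidalForm gbar i j (x (.inl 0)) with hK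
  set Γ := fun p i => christoffel (planeWave gbar) p a i x with hΓ
  -- In each of the four slots, the terms containing `drComponent p` vanish by `hdr`; only
  -- corrections to `K` survive.
  have h1 : ∑ p, Γ p i * (drComponent j * drComponent k * K p l
        - drComponent p * drComponent k * K j l - drComponent j * drComponent l * K p k
        + drComponent p * drComponent l * K j k)
      = drComponent j * drComponent k * ∑ p, Γ p i * K p l
        - drComponent j * drComponent l * ∑ p, Γ p i * K p k := by
    simp only [Finset.mul_sum, ← Finset.sum_sub_distrib]
    refine Finset.sum_congr rfl fun p _ => ?_
    linear_combination (drComponent l * K j k - drComponent k * K j l) * hdr i x p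
  have h2 : ∑ p, Γ p j * (drComponent p * drComponent k * K i l
        - drComponent i * drComponent k * K p l - drComponent p * drComponent l * K i k
        + drComponent i * drComponent l * K p k)
      = drComponent i * drComponent l * ∑ p, Γ p j * K p k
        - drComponent i * drComponent k * ∑ p, Γ p j * K p l := by
    simp only [Finset.mul_sum, ← Finset.sum_sub_distrib]
    refine Finset.sum_congr rfl fun p _ => ?_
    linear_combination (drComponent k * K i l - drComponent l * K i k) * hdr j x p
  have h3 : ∑ p, Γ p k * (drComponent j * drComponent p * K i l
        - drComponent i * drComponent p * K j l - drComponent j * drComponent l * K i p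
        + drComponent i * drComponent l * K j p)
      = drComponent i * drComponent l * ∑ p, Γ p k * K j p
        - drComponent j * drComponent l * ∑ p, Γ p k * K i p := by
    simp only [Finset.mul_sum, ← Finset.sum_sub_distrib]
    refine Finset.sum_congr rfl fun p _ => ?_
    linear_combination (drComponent j * K i l - drComponent i * K j l) * hdr k x p
  have h4 : ∑ p, Γ p l * (drComponent j * drComponent k * K i p
        - drComponent i * drComponent k * K j p - drComponent j * drComponent p * K i k
        + drComponent i * drComponent p * K j k)
      = drComponent j * drComponent k * ∑ p, Γ p l * K i p
        - drComponent i * drComponent k * ∑ p, Γ p l * K j p := by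
    simp only [Finset.mul_sum, ← Finset.sum_sub_distrib]
    refine Finset.sum_congr rfl fun p _ => ?_
    linear_combination (drComponent i * K j k - drComponent j * K i k) * hdr l x p
  rw [h1, h2, h3, h4]
  -- The terms in `V` cancel: the product of `dr²` with a symmetric product `dr · V` is zero.
  linear_combination drComponent j * drComponent k * hV i l
    - drComponent i * drComponent k * hV j l - drComponent j * drComponent l * hV i k
    + drComponent i * drComponent l * hV j k

theorem ricciFlat_planeWave (hsymm : ∀ r, (gbar r).IsSymm)
    (h : ∀ s, ∑ i, tidal gbar i i s = 0) : RicciFlat (planeWave gbar) := by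
  intro x i j
  rw [ricci_planeWave hsmooth hunit hsymm, h, mul_zero]

theorem parallelRicci_planeWave (hsymm : ∀ r, (gbar r).IsSymm)
    (h : ∀ s, deriv (fun s => ∑ i, tidal gbar i i s) s = 0) :
    ParallelRicci (planeWave gbar) := by
  intro x a i j
  have hdr := christoffel_mul_drComponent hsmooth hunit a
  have e : ricci (planeWave gbar) i j = _ :=
    funext fun x => ricci_planeWave hsmooth hunit hsymm i j x
  rw [covDerivRicci, e, pd_comp_coord
    (φ := fun r => drComponent i * drComponent j * ∑ i, tidal gbar i i r)
    (contDiff_const.mul (ContDiff.sum fun i _ => contDiff_tidal hsmooth hunit i i)),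
    deriv_const_mul_field, h]
  simp only [ricci_planeWave hsmooth hunit hsymm]
  rw [Finset.sum_eq_zero fun p _ => ?_, Finset.sum_eq_zero fun p _ => ?_]
  · simp
  · linear_combination (drComponent i * ∑ i, tidal gbar i i (x (.inl 0))) * hdr j x p
  · linear_combination (drComponent j * ∑ i, tidal gbar i i (x (.inl 0))) * hdr i x p

end PlaneWave

/-! ### Transfer from a Riemannian extension to the plane wave. -/

section RiemannianExtension

variable {m : ℕ} {gbar : ℝ → Matrix (Fin m) (Fin m) ℝ}
  {gR : (Fin 1 ⊕ Fin m → ℝ) → Matrix (Fin 1 ⊕ Fin m) (Fin 1 ⊕ Fin m) ℝ}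
  (hpos : ∀ r, (gbar r).PosDef) (hgR : gR ∈ riemannianExtensions gbar)

include hgR in
theorem exists_block_of_mem_riemannianExtensions :
    ∃ G : (Fin 1 ⊕ Fin m → ℝ) → Matrix (Fin m) (Fin m) ℝ,
      (∀ x, gR x = Matrix.fromBlocks 1 0 0 (G x)) ∧ (∀ x, IsUnit (G x).det) ∧
      ∀ s, G (update 0 (.inl 0) s) = gbar s := by
  obtain ⟨hR, G, hG, hline⟩ := hgR
  refine ⟨G, hG, fun x => ?_, fun s => ?_⟩
  · have h := (hR.posDef x).det_pos
    rw [hG, Matrix.det_fromBlocks_zero₂₁, Matrix.det_one, one_mul] at h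
    exact h.ne'.isUnit
  · rw [← hline]
    congr 1
    funext i
    rcases i with i | i
    · fin_cases i
      simp
    · simp

variable (hsmooth : ∀ i j, ContDiff ℝ ∞ fun r => gbar r i j)
include hpos hgR hsmooth

theorem RicciFlat.planeWave_of_mem (h : RicciFlat gR) : RicciFlat (planeWave gbar) := by
  obtain ⟨G, hG, hu, hline⟩ := exists_block_of_mem_riemannianExtensions hgR
  refine ricciFlat_planeWave hsmooth (fun r => (hpos r).det_pos.ne'.isUnit)
    -- Over `ℝ` the star is trivial, so Hermitian unfolds to symmetric.
    (fun r => (hpos r).isHermitian) fun s => ?_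
  rw [← ricci_inl_inl hG (by simp) hu hgR.1.smooth hline]
  exact h _ _ _

theorem LocallySymmetric.planeWave_of_mem (h : LocallySymmetric gR) :
    LocallySymmetric (planeWave gbar) := by
  obtain ⟨G, hG, hu, hline⟩ := exists_block_of_mem_riemannianExtensions hgR
  refine locallySymmetric_planeWave hsmooth (fun r => (hpos r).det_pos.ne'.isUnit)
    (fun r => (hpos r).isHermitian) fun i j s => ?_
  rw [← covDerivRiemann_inl hG (by simp) hu hgR.1.smooth hline]
  exact h _ _ _ _ _ _

theorem ParallelRicci.planeWave_of_mem (h : ParallelRicci gR) :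
    ParallelRicci (planeWave gbar) := by
  obtain ⟨G, hG, hu, hline⟩ := exists_block_of_mem_riemannianExtensions hgR
  refine parallelRicci_planeWave hsmooth (fun r => (hpos r).det_pos.ne'.isUnit)
    (fun r => (hpos r).isHermitian) fun s => ?_
  rw [← covDerivRicci_inl hG (by simp) hu hgR.1.smooth hline]
  exact h _ _ _ _

end RiemannianExtension

end CoordMetric

theorem mainTheorem5 (m : ℕ) (gbar : ℝ → Matrix (Fin m) (Fin m) ℝ)
    (hsmooth : ∀ i j, ContDiff ℝ ∞ (fun r => gbar r i j))
    (hpos : ∀ r, (gbar r).PosDef) :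
    (¬ CoordMetric.RicciFlat (planeWave gbar) →
      ∀ gR ∈ riemannianExtensions gbar, ¬ CoordMetric.RicciFlat gR) ∧
    (¬ CoordMetric.LocallySymmetric (planeWave gbar) →
      ∀ gR ∈ riemannianExtensions gbar, ¬ CoordMetric.LocallySymmetric gR) ∧
    (¬ CoordMetric.ParallelRicci (planeWave gbar) →
      ∀ gR ∈ riemannianExtensions gbar, ¬ CoordMetric.ParallelRicci gR) :=
  ⟨fun hn _ hgR h => hn (h.planeWave_of_mem hpos hgR hsmooth),
    fun hn _ hgR h => hn (h.planeWave_of_mem hpos hgR hsmooth),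
    fun hn _ hgR h => hn (h.planeWave_of_mem hpos hgR hsmooth)⟩
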